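/- For every $\varepsilon>0$ and every function $\omega:\mathbb N\to\mathbb R$ with $\omega(n)\to 0$ as $n\to\infty$ there is a function $\eta:\mathbb N\to\mathbb R$ with $\eta(n)\to 0$ as $n\to\infty$ such that the following holds for all integers $n\ge 1$ and $M\ge 2$ and every integer $\tau$ with $|\tau|\le \omega(n)\,Mn$. Let $C=\{1,-1\}$ and let $\mathbf x$ be uniformly distributed on $\{0,1,\dots,M-1\}^n$. Then $$\Pr_{\mathbf x}\big[\exists\, c\in C^n:\ \mathbf x\cdot c\in\{\tau,\tau+1\}\big]\ \begin{cases}\ \ge\ 1-\eta(n) & \text{if } M\le 2^{(1-\varepsilon)n},\\[2pt] \ \le\ 2\cdot 2^n/M & \text{if } M\ge 2^n.\end{cases}$$ (Here $|\tau|\le\omega(n)Mn$ with $\omega(n)\to0$ is the meaning of $|\tau|=o(Mn)$, and $\eta(n)$ is the $o_n(1)$ term; $\eta$ depends only on $\varepsilon$ and $\omega$.) -/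

import Mathlib

open Filter Topology

/-- The set `[0 : M - 1]^n` of integer vectors of length `n` with entries in `{0, …, M - 1}`. -/
def inputBox (n M : ℕ) : Set (Fin n → ℤ) :=
  {x | ∀ i, x i ∈ Set.Icc (0 : ℤ) ((M : ℤ) - 1)}

/-- The coefficient set `C(d) = {±1, …, ±d}`. -/
def coeffSet (d : ℕ) : Set ℤ :=
  {a | a ≠ 0 ∧ |a| ≤ (d : ℤ)}

/-- The vectors `x` for which some coefficient vector `c ∈ C^n` has `x · c ∈ T`. -/
def solvable (n : ℕ) (C T : Set ℤ) : Set (Fin n → ℤ) :=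
  {x | ∃ c : Fin n → ℤ, (∀ i, c i ∈ C) ∧ x ⬝ᵥ c ∈ T}

/-- The probability, over `x` uniform on `[0 : M - 1]^n`, that some `c ∈ C^n` has `x · c ∈ T`. -/
noncomputable def solutionProb (n M : ℕ) (C T : Set ℤ) : ℝ :=
  (ProbabilityTheory.uniformOn (inputBox n M)).real (solvable n C T)

/-! Upper bound: for fixed signs `c`, one coordinate of `x` has at most two values hitting the
target pair, so each `c` succeeds with probability at most 2/M, and a union bound over the 2^n sign
vectors finishes.

Lower bound: a second moment argument on x·c directly is lossy, because x·c spreads over a range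
much longer than M. Instead the coordinates are split as n = m + k + 1 into a bulk `u`, a short
steering block `w` and one last coordinate `y`. With high probability `w` is `Steerable`: its signed
sums approximate every target of size up to order kM within e, about M/D. So for each quotient j =
⌊u·c/M⌋ with |j| ≤ J one fixed steering vector gives a correction r(j) close to τ - M + 1 - jM. The
corrected sum u·c + r(j) then lies in a window of length about M, and it solves the problem for
exactly two integers y in a slightly enlarged copy of [0, M).

Chebyshev's inequality over y and u bounds the y hit by no `c`. All signed sums of a fixed vector
have the same parity, so two such pairs of y are equal or disjoint, and the second moment counts
`Collision`s. Two sign vectors differing in two places collide with probability at most 2/M up to an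
error of order (e + 1)/M² (`sq_mul_card_collision_le`); with this sharp constant the main terms
cancel in `sum_card_uncovered_le`. What remains is small since M/2^m decays exponentially and e/M is
about 1/D. When M < D, steering alone hits the target. -/

/-! ### Averaging over a product box: resampling a coordinate, variance of a sum. -/

theorem sum_piFinset_sum_update {ι β : Type*} [Fintype ι] [DecidableEq ι] [AddCommMonoid β]
    (Y : Finset ℤ) (i : ι) (f : (ι → ℤ) → β) :
    ∑ x ∈ Fintype.piFinset (fun _ : ι => Y), ∑ y ∈ Y, f (Function.update x i y) =
      Y.card • ∑ x ∈ Fintype.piFinset (fun _ : ι => Y), f x := by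
  rw [← Finset.sum_product', Finset.smul_sum]
  have h : ∀ x ∈ Fintype.piFinset (fun _ : ι => Y), Y.card • f x = ∑ y ∈ Y, f x := by
    intro x _; rw [Finset.sum_const]
  rw [Finset.sum_congr rfl h, ← Finset.sum_product']
  -- Exchanging `y` with the coordinate `x i` is an involution on pairs.
  refine Finset.sum_nbij' (fun p => (Function.update p.1 i p.2, p.1 i))
    (fun p => (Function.update p.1 i p.2, p.1 i)) ?_ ?_ ?_ ?_ ?_
  · rintro ⟨x, y⟩ h
    simp only [Finset.mem_product, Fintype.mem_piFinset] at h ⊢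
    refine ⟨fun a => ?_, h.1 i⟩
    by_cases ha : a = i
    · subst ha; simpa using h.2
    · simpa [ha] using h.1 a
  · rintro ⟨x, y⟩ h
    simp only [Finset.mem_product, Fintype.mem_piFinset] at h ⊢
    refine ⟨fun a => ?_, h.1 i⟩
    by_cases ha : a = i
    · subst ha; simpa using h.2
    · simpa [ha] using h.1 a
  · rintro ⟨x, y⟩ _; simp
  · rintro ⟨x, y⟩ _; simp
  · rintro ⟨x, y⟩ _; simp

/-- A fibrewise bound on the number of admissible values of one coordinate bounds the count. -/
theorem card_mul_card_filter_piFinset_le {ι : Type*} [Fintype ι] [DecidableEq ι]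
    (Y : Finset ℤ) (i : ι) (p : (ι → ℤ) → Prop) [DecidablePred p] (K : (ι → ℤ) → ℕ)
    (h : ∀ x ∈ Fintype.piFinset (fun _ : ι => Y),
      (Y.filter fun y => p (Function.update x i y)).card ≤ K x) :
    Y.card * ((Fintype.piFinset (fun _ : ι => Y)).filter p).card ≤
      ∑ x ∈ Fintype.piFinset (fun _ : ι => Y), K x := by
  have := sum_piFinset_sum_update Y i (fun x => if p x then 1 else 0)
  rw [Finset.card_filter, ← smul_eq_mul, ← this]
  refine Finset.sum_le_sum fun x hx => ?_
  rw [← Finset.card_filter]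
  exact h x hx

/-- Variances of independent centred terms add: resampling coordinate `i` averages `f i` to zero, so
cross terms vanish. It serves both random signs and random box vectors. -/
theorem sum_piFinset_sq_sum_le {ι : Type*} [Fintype ι] [DecidableEq ι] (Y : Finset ℤ) (f : ι → ℤ → ℝ) (b : ι → ℝ)
    (h0 : ∀ i, ∑ y ∈ Y, f i y = 0) (hb : ∀ i, ∑ y ∈ Y, f i y ^ 2 ≤ Y.card * b i) :
    ∑ x ∈ Fintype.piFinset (fun _ : ι => Y), (∑ i, f i (x i)) ^ 2 ≤
      (Y.card : ℝ) ^ Fintype.card ι * ∑ i, b i := by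
  rcases Y.eq_empty_or_nonempty with hY | hY
  · rcases isEmpty_or_nonempty ι with hι | hι
    · simp
    · subst hY
      simp
  have hYpos : (0 : ℝ) < Y.card := by exact_mod_cast hY.card_pos
  have hcard : ((Fintype.piFinset (fun _ : ι => Y)).card : ℝ) = (Y.card : ℝ) ^ Fintype.card ι := by
    rw [Fintype.card_piFinset]; simp
  have key : ∀ i j, ∑ x ∈ Fintype.piFinset (fun _ : ι => Y), f i (x i) * f j (x j) ≤
      if i = j then (Y.card : ℝ) ^ Fintype.card ι * b i else 0 := by
    intro i j
    have hu := sum_piFinset_sum_update Y i (fun x => f i (x i) * f j (x j))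
    rw [nsmul_eq_mul] at hu
    split_ifs with hij
    · subst hij
      have h1 : ∑ x ∈ Fintype.piFinset (fun _ : ι => Y), ∑ y ∈ Y,
          f i (Function.update x i y i) * f i (Function.update x i y i) ≤
          ∑ x ∈ Fintype.piFinset (fun _ : ι => Y), Y.card * b i := by
        refine Finset.sum_le_sum fun x _ => ?_
        simpa [pow_two] using hb i
      rw [hu, Finset.sum_const, nsmul_eq_mul, hcard] at h1
      have : (Y.card : ℝ) * ∑ x ∈ Fintype.piFinset (fun _ : ι => Y), f i (x i) * f i (x i) ≤
          Y.card * ((Y.card : ℝ) ^ Fintype.card ι * b i) := by linarith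
      exact le_of_mul_le_mul_left this hYpos
    · have h1 : ∑ x ∈ Fintype.piFinset (fun _ : ι => Y), ∑ y ∈ Y,
          f i (Function.update x i y i) * f j (Function.update x i y j) = 0 := by
        refine Finset.sum_eq_zero fun x _ => ?_
        have : ∀ y, Function.update x i y j = x j := fun y => by
          simp [Function.update_of_ne (Ne.symm hij)]
        simp only [Function.update_self, this, ← Finset.sum_mul, h0 i, zero_mul]
      rw [h1] at hu
      rcases mul_eq_zero.1 hu.symm with h | h
      · exact absurd h hYpos.ne'
      · exact h.le
  calc ∑ x ∈ Fintype.piFinset (fun _ : ι => Y), (∑ i, f i (x i)) ^ 2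
      = ∑ i, ∑ j, ∑ x ∈ Fintype.piFinset (fun _ : ι => Y), f i (x i) * f j (x j) := by
        simp_rw [pow_two, Finset.sum_mul_sum]
        rw [Finset.sum_comm]
        refine Finset.sum_congr rfl fun i _ => Finset.sum_comm
    _ ≤ ∑ i, ∑ j, if i = j then (Y.card : ℝ) ^ Fintype.card ι * b i else 0 :=
        Finset.sum_le_sum fun i _ => Finset.sum_le_sum fun j _ => key i j
    _ = _ := by simp [Finset.mul_sum]

/-! ### The probability as a finite count. -/

/-- The vectors with entries in `{0, …, M - 1}`, as a finset. -/
noncomputable def intBox (n M : ℕ) : Finset (Fin n → ℤ) :=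
  Fintype.piFinset fun _ => Finset.Ico (0 : ℤ) M

/-- The sign vectors of length `n`. -/
def signVectors (n : ℕ) : Finset (Fin n → ℤ) :=
  Fintype.piFinset fun _ => ({1, -1} : Finset ℤ)

theorem mem_intBox {n M : ℕ} {x : Fin n → ℤ} : x ∈ intBox n M ↔ ∀ i, 0 ≤ x i ∧ x i < M := by
  simp [intBox]

theorem mem_signVectors {n : ℕ} {c : Fin n → ℤ} :
    c ∈ signVectors n ↔ ∀ i, c i = 1 ∨ c i = -1 := by
  simp [signVectors]

theorem card_intBox (n M : ℕ) : (intBox n M).card = M ^ n := by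
  simp [intBox]

theorem card_signVectors (n : ℕ) : (signVectors n).card = 2 ^ n := by
  simp [signVectors]

theorem coeffSet_one : coeffSet 1 = {1, -1} := by
  ext a
  simp only [coeffSet, Set.mem_ofPred_eq, Nat.cast_one, abs_le, Set.mem_insert_iff,
    Set.mem_singleton_iff]
  omega

theorem ncard_coeffSet_one : (coeffSet 1).ncard = 2 := by
  rw [coeffSet_one, Set.ncard_pair (by norm_num)]

theorem solutionProb_coeffSet_one (n M : ℕ) (τ : ℤ) :
    solutionProb n M (coeffSet 1) {τ, τ + 1} =
      ((intBox n M).filter fun x => ∃ c ∈ signVectors n,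
        ∑ i, x i * c i = τ ∨ ∑ i, x i * c i = τ + 1).card / (M : ℝ) ^ n := by
  have hbox : inputBox n M = (intBox n M : Set (Fin n → ℤ)) := by
    ext x
    simp only [inputBox, Set.mem_ofPred_eq, Set.mem_Icc, Finset.mem_coe, mem_intBox]
    refine forall_congr' fun i => ?_
    omega
  have hinter : inputBox n M ∩ solvable n (coeffSet 1) {τ, τ + 1} =
      ((intBox n M).filter fun x => ∃ c ∈ signVectors n,
        ∑ i, x i * c i = τ ∨ ∑ i, x i * c i = τ + 1 : Finset _) := by
    ext x
    simp [hbox, solvable, coeffSet_one, mem_signVectors, dotProduct]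
  rw [solutionProb, MeasureTheory.measureReal_def, ProbabilityTheory.uniformOn,
    ProbabilityTheory.cond_apply (by rw [hbox]; exact Finset.measurableSet _), hinter, hbox,
    MeasureTheory.Measure.count_apply_finset, MeasureTheory.Measure.count_apply_finset,
    card_intBox]
  simp [ENNReal.toReal_mul, ENNReal.toReal_inv]
  ring

/-! ### The upper bound by a union bound. -/

theorem sum_update_mul {n : ℕ} (x c : Fin n → ℤ) (b : Fin n) (y : ℤ) :
    ∑ i, Function.update x b y i * c i = ∑ i, x i * c i + (y - x b) * c b := by
  have h : ∀ i, Function.update x b y i * c i = x i * c i + if i = b then (y - x b) * c b else 0 := by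
    intro i
    by_cases hi : i = b
    · subst hi; simp; ring
    · simp [hi]
  simp [h, Finset.sum_add_distrib]

/-- A coefficient ±1 makes the sum injective in coordinate `b`, so at most two of its values hit the
pair. -/
theorem mul_card_filter_sum_mem_pair_le {n : ℕ} (M : ℕ) (τ : ℤ) (b : Fin n) {c : Fin n → ℤ}
    (hc : c ∈ signVectors n) :
    M * ((intBox n M).filter fun x => (∑ i, x i * c i = τ ∨ ∑ i, x i * c i = τ + 1)).card ≤ 2 * M ^ n := by
  have h := card_mul_card_filter_piFinset_le (Finset.Ico (0 : ℤ) M) b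
    (fun x : Fin n → ℤ => (∑ i, x i * c i = τ ∨ ∑ i, x i * c i = τ + 1)) (fun _ => 2) (by
      intro x _
      refine (Finset.card_le_card_of_injOn (t := ({τ, τ + 1} : Finset ℤ))
        (fun y => ∑ i, Function.update x b y i * c i) ?_ ?_).trans Finset.card_le_two
      · intro y hy
        simpa using (Finset.mem_filter.1 hy).2
      · intro y _ y' _ hyy
        simp only [sum_update_mul] at hyy
        rcases mem_signVectors.1 hc b with hb | hb <;> rw [hb] at hyy <;> linarith)
  rw [← intBox, Finset.sum_const, card_intBox, smul_eq_mul, mul_comm (M ^ n)] at h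
  simpa using h

theorem solutionProb_pair_le {n M : ℕ} (hn : 1 ≤ n) (hM : 1 ≤ M) (τ : ℤ) :
    solutionProb n M (coeffSet 1) {τ, τ + 1} ≤ 2 * (2 : ℝ) ^ n / M := by
  rw [solutionProb_coeffSet_one]
  have hMpos : (0 : ℝ) < M := by exact_mod_cast hM
  rw [div_le_div_iff₀ (by positivity) hMpos]
  have h : M * ((intBox n M).filter fun x => ∃ c ∈ signVectors n,
      (∑ i, x i * c i = τ ∨ ∑ i, x i * c i = τ + 1)).card ≤ 2 ^ n * (2 * M ^ n) := by
    have hsub : ((intBox n M).filter fun x => ∃ c ∈ signVectors n,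
        (∑ i, x i * c i = τ ∨ ∑ i, x i * c i = τ + 1)) ⊆ (signVectors n).biUnion fun c =>
        (intBox n M).filter fun x => (∑ i, x i * c i = τ ∨ ∑ i, x i * c i = τ + 1) := by
      intro x hx
      obtain ⟨hx, c, hc, h⟩ := Finset.mem_filter.1 hx
      exact Finset.mem_biUnion.2 ⟨c, hc, Finset.mem_filter.2 ⟨hx, h⟩⟩
    calc _ ≤ M * ∑ c ∈ signVectors n,
          ((intBox n M).filter fun x => (∑ i, x i * c i = τ ∨ ∑ i, x i * c i = τ + 1)).card :=
          Nat.mul_le_mul_left _ ((Finset.card_le_card hsub).trans Finset.card_biUnion_le)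
      _ ≤ ∑ _c ∈ signVectors n, 2 * M ^ n := by
          rw [Finset.mul_sum]
          exact Finset.sum_le_sum fun c hc => mul_card_filter_sum_mem_pair_le M τ ⟨0, hn⟩ hc
      _ = _ := by rw [Finset.sum_const, card_signVectors, smul_eq_mul]
  have h' : (M : ℝ) * (((intBox n M).filter fun x => ∃ c ∈ signVectors n,
      (∑ i, x i * c i = τ ∨ ∑ i, x i * c i = τ + 1)).card : ℝ) ≤ 2 ^ n * (2 * M ^ n) := by
    exact_mod_cast h
  linarith

/-! ### Collision probability of two sign vectors. -/

-- After a shift by 2e the residue modulo `M` lies in [0, 4e], while the quotient takes at most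
-- three values because 2z varies over less than 2M. Quotient and residue determine z.
open Classical in
theorem card_filter_near_multiple_le (M e : ℕ) (C : ℤ) :
    ((Finset.Ico (0 : ℤ) M).filter fun z => ∃ k : ℤ, |C + 2 * z - k * M| ≤ 2 * e).card ≤
      3 * (4 * e + 1) := by
  by_cases hMe : M ≤ 4 * e
  · refine (Finset.card_filter_le _ _).trans ?_
    simp; omega
  have hM : (0 : ℤ) < M := by omega
  refine (Finset.card_le_card_of_injOn
    (t := Finset.Icc ((C + 2 * e) / M) ((C + 2 * e) / M + 2) ×ˢ Finset.Icc (0 : ℤ) (4 * e))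
    (fun z => ((C + 2 * e + 2 * z) / M, (C + 2 * e + 2 * z) % M)) ?_ ?_).trans ?_
  · intro z hz
    obtain ⟨hz, k, hk⟩ := Finset.mem_filter.1 hz
    rw [Finset.mem_Ico] at hz
    rw [abs_le] at hk
    have hmod : (C + 2 * e + 2 * z) % M = C + 2 * e + 2 * z - k * M := by
      have h1 : C + 2 * e + 2 * z = (C + 2 * e + 2 * z - k * M) + k * M := by ring
      rw [h1, Int.add_mul_emod_self_right, Int.emod_eq_of_lt (by linarith) (by omega)]
      ring
    have hup : (C + 2 * e + 2 * z) / (M : ℤ) ≤ (C + 2 * e) / M + 2 := by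
      rw [← Int.add_mul_ediv_right _ _ hM.ne']
      exact Int.ediv_le_ediv hM (by linarith)
    have hlo : (C + 2 * e) / (M : ℤ) ≤ (C + 2 * e + 2 * z) / M :=
      Int.ediv_le_ediv hM (by linarith)
    simp only [Finset.coe_product, Set.mem_prod, Finset.mem_coe, Finset.mem_Icc]
    refine ⟨⟨hlo, hup⟩, Int.emod_nonneg _ hM.ne', ?_⟩
    rw [hmod]; linarith
  · intro z _ z' _ h
    simp only [Prod.mk.injEq] at h
    have h1 := Int.mul_ediv_add_emod (C + 2 * e + 2 * z) M
    have h2 := Int.mul_ediv_add_emod (C + 2 * e + 2 * z') M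
    rw [h.1, h.2] at h1
    linarith
  · rw [Finset.card_product]
    simp
    refine Nat.mul_le_mul ?_ ?_ <;> omega

-- Here `P + y` and `Q - y` are two signed sums as functions of a coordinate on which the signs
-- differ. The difference k of their quotients determines y, and the collision equation confines kM
-- to an interval of length 2M + 4e. That leaves two values of k unless `P - Q` is within 2e of a
-- multiple of `M`, when three are allowed.
open Classical in
theorem card_filter_collision_le {M e : ℕ} (hM : 0 < M) (J t P Q : ℤ) (r : ℤ → ℤ)
    (hr : ∀ j, |j| ≤ J → |r j + j * M - t| ≤ e) :
    ((Finset.Ico (0 : ℤ) M).filter fun y => |(P + y) / M| ≤ J ∧ |(Q - y) / M| ≤ J ∧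
      P + y + r ((P + y) / M) = Q - y + r ((Q - y) / M)).card ≤
      2 + if ∃ k : ℤ, |P - Q - k * M| ≤ 2 * e then 1 else 0 := by
  have hM' : (0 : ℤ) < M := by exact_mod_cast hM
  set Y := (Finset.Ico (0 : ℤ) M).filter fun y => |(P + y) / M| ≤ J ∧ |(Q - y) / M| ≤ J ∧
      P + y + r ((P + y) / M) = Q - y + r ((Q - y) / M) with hY
  -- The first quotient increases with y and the second decreases, so equal differences force both
  -- to agree; the collision equation is then linear in y.
  have hinj : Set.InjOn (fun y => (P + y) / (M : ℤ) - (Q - y) / M) Y := by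
    have aux : ∀ y ∈ Y, ∀ y' ∈ Y, y ≤ y' →
        (P + y) / (M : ℤ) - (Q - y) / M = (P + y') / (M : ℤ) - (Q - y') / M → y = y' := by
      intro y hy y' hy' hle h
      have h1 : (P + y) / (M : ℤ) ≤ (P + y') / M := Int.ediv_le_ediv hM' (by linarith)
      have h2 : (Q - y') / (M : ℤ) ≤ (Q - y) / M := Int.ediv_le_ediv hM' (by linarith)
      have e1 : (P + y) / (M : ℤ) = (P + y') / M := by linarith
      have e2 : (Q - y') / (M : ℤ) = (Q - y) / M := by linarith
      have g := (Finset.mem_filter.1 hy).2.2.2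
      have g' := (Finset.mem_filter.1 hy').2.2.2
      rw [e1, ← e2] at g
      linarith
    intro y hy y' hy' h
    rcases le_total y y' with hle | hle
    · exact aux y hy y' hy' hle h
    · exact (aux y' hy' y hy hle h.symm).symm
  have hbound : ∀ y ∈ Y, P - Q - 2 * e ≤ ((P + y) / (M : ℤ) - (Q - y) / M) * M ∧
      ((P + y) / (M : ℤ) - (Q - y) / M - 2) * M ≤ P - Q + 2 * e := by
    intro y hy
    obtain ⟨hy0, h1, h2, h3⟩ := Finset.mem_filter.1 hy
    rw [Finset.mem_Ico] at hy0
    have a1 := abs_le.1 (hr _ h1)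
    have a2 := abs_le.1 (hr _ h2)
    constructor <;> linarith
  split_ifs with hnear
  · refine (Finset.card_le_card_of_injOn (t := Finset.Icc (P / (M : ℤ) - Q / M)
      (P / (M : ℤ) - Q / M + 2)) _ ?_ hinj).trans (by simp; omega)
    intro y hy
    have hy0 := Finset.mem_Ico.1 (Finset.mem_filter.1 hy).1
    have b1 : P / (M : ℤ) ≤ (P + y) / M := Int.ediv_le_ediv hM' (by linarith)
    have b2 : (Q - y) / (M : ℤ) ≤ Q / M := Int.ediv_le_ediv hM' (by linarith)
    have b3 : (P + y) / (M : ℤ) ≤ P / M + 1 := by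
      rw [← Int.add_mul_ediv_right _ _ hM'.ne']
      exact Int.ediv_le_ediv hM' (by linarith)
    have b4 : Q / (M : ℤ) + (-1) ≤ (Q - y) / M := by
      rw [← Int.add_mul_ediv_right _ _ hM'.ne']
      exact Int.ediv_le_ediv hM' (by linarith)
    simp only [Finset.coe_Icc, Set.mem_Icc]
    constructor <;> linarith
  · push Not at hnear
    refine (Finset.card_le_card_of_injOn (t := Finset.Icc ((P - Q) / (M : ℤ) + 1)
      ((P - Q) / (M : ℤ) + 2)) _ ?_ hinj).trans (by simp)
    intro y hy
    obtain ⟨h1, h2⟩ := hbound y hy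
    set k := (P + y) / (M : ℤ) - (Q - y) / M with hk
    have n1 := lt_abs.1 (hnear k)
    have n2 := lt_abs.1 (hnear (k - 2))
    have c1 : (P - Q) / (M : ℤ) < k := by
      rw [Int.ediv_lt_iff_lt_mul hM']
      rcases n1 with n1 | n1 <;> linarith
    have c2 : k - 2 ≤ (P - Q) / (M : ℤ) := by
      rw [Int.le_ediv_iff_mul_le hM']
      rcases n2 with n2 | n2 <;> linarith
    simp only [Finset.coe_Icc, Set.mem_Icc, ← hk]
    constructor <;> linarith

/-- Two coefficient vectors collide at `x` when their corrected sums agree. -/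
def Collision {n : ℕ} (M : ℕ) (J : ℤ) (r : ℤ → ℤ) (c c' x : Fin n → ℤ) : Prop :=
  |(∑ i, x i * c i) / M| ≤ J ∧ |(∑ i, x i * c' i) / M| ≤ J ∧
    ∑ i, x i * c i + r ((∑ i, x i * c i) / M) = ∑ i, x i * c' i + r ((∑ i, x i * c' i) / M)

theorem Collision.symm {n M : ℕ} {J : ℤ} {r : ℤ → ℤ} {c c' x : Fin n → ℤ}
    (h : Collision M J r c c' x) : Collision M J r c' c x :=
  ⟨h.2.1, h.1, h.2.2.symm⟩

-- Resampling `b` leaves two colliding values, or three in the near-multiple case; resampling the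
-- second differing coordinate `b'` shows that this case is rare. The main term 2/M must be sharp,
-- which is why the third value is charged separately.
open Classical in
theorem sq_mul_card_collision_le {n M e : ℕ} (hM : 0 < M) (J t : ℤ) (r : ℤ → ℤ)
    (hr : ∀ j, |j| ≤ J → |r j + j * M - t| ≤ e) {c c' : Fin n → ℤ}
    (hc : c ∈ signVectors n) (hc' : c' ∈ signVectors n) {b b' : Fin n} (hbb : b ≠ b')
    (hb : c b ≠ c' b) (hb' : c b' ≠ c' b') :
    M * (M * ((intBox n M).filter (Collision M J r c c')).card) ≤
      (2 * M + 3 * (4 * e + 1)) * M ^ n := by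
  wlog h1 : c b = 1 generalizing c c'
  · have h := this hc' hc hb.symm hb'.symm (by
      rcases mem_signVectors.1 hc b with h | h <;> rcases mem_signVectors.1 hc' b with h' | h' <;>
        simp_all)
    have hsymm : (intBox n M).filter (Collision M J r c c') =
        (intBox n M).filter (Collision M J r c' c) :=
      Finset.filter_congr fun x _ => ⟨Collision.symm, Collision.symm⟩
    rwa [hsymm]
  have h1' : c' b = -1 := by
    rcases mem_signVectors.1 hc' b with h | h
    · rw [h1, h] at hb; exact absurd rfl hb
    · exact h
  let near : (Fin n → ℤ) → Prop := fun x =>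
    ∃ k : ℤ, |∑ i, x i * c i - x b - (∑ i, x i * c' i + x b) - k * M| ≤ 2 * e
  have step1 := card_mul_card_filter_piFinset_le (Finset.Ico (0 : ℤ) M) b (Collision M J r c c')
    (fun x => 2 + if near x then 1 else 0) (by
      intro x _
      refine le_trans (le_of_eq ?_) (card_filter_collision_le hM J t (∑ i, x i * c i - x b)
        (∑ i, x i * c' i + x b) r hr)
      congr 1
      refine Finset.filter_congr fun y _ => ?_
      have e1 : ∑ i, x i * c i + (y - x b) * 1 = ∑ i, x i * c i - x b + y := by ring
      have e2 : ∑ i, x i * c' i + (y - x b) * -1 = ∑ i, x i * c' i + x b - y := by ring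
      simp only [Collision, sum_update_mul, h1, h1', e1, e2])
  -- Since `b ≠ b'`, the entry `x b` stays fixed, and the difference of the sums moves by ±2y.
  have step2 := card_mul_card_filter_piFinset_le (Finset.Ico (0 : ℤ) M) b' near
    (fun _ => 3 * (4 * e + 1)) (by
      intro x _
      have hupd : ∀ y, Function.update x b' y b = x b := fun y => by
        simp [Function.update_of_ne hbb]
      rcases mem_signVectors.1 hc b' with h | h <;> rcases mem_signVectors.1 hc' b' with h' | h'
      · rw [h, h'] at hb'; exact absurd rfl hb'
      · refine le_trans (Finset.card_le_card ?_) (card_filter_near_multiple_le M e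
          (∑ i, x i * c i - x b - (∑ i, x i * c' i + x b) - 2 * x b'))
        intro y hy
        obtain ⟨hy0, k, hk⟩ := Finset.mem_filter.1 hy
        refine Finset.mem_filter.2 ⟨hy0, k, le_of_eq_of_le ?_ hk⟩
        simp only [sum_update_mul, h, h', hupd]
        congr 1; ring
      · refine le_trans (Finset.card_le_card ?_) (card_filter_near_multiple_le M e
          (-(∑ i, x i * c i - x b - (∑ i, x i * c' i + x b) + 2 * x b')))
        intro y hy
        obtain ⟨hy0, k, hk⟩ := Finset.mem_filter.1 hy
        refine Finset.mem_filter.2 ⟨hy0, -k, le_of_eq_of_le ?_ hk⟩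
        simp only [sum_update_mul, h, h', hupd]
        rw [← abs_neg]
        congr 1; ring
      · rw [h, h'] at hb'; exact absurd rfl hb')
  rw [← intBox, Finset.sum_add_distrib, ← Finset.card_filter, Finset.sum_const,
    card_intBox] at step1
  rw [← intBox, Finset.sum_const, card_intBox] at step2
  simp only [Int.card_Ico, sub_zero, Int.toNat_natCast, smul_eq_mul] at step1 step2
  calc _ ≤ M * (M ^ n * 2 + _) := Nat.mul_le_mul_left _ step1
    _ = 2 * M * M ^ n + M * _ := by rw [Nat.mul_add]; congr 1; ring
    _ ≤ 2 * M * M ^ n + M ^ n * (3 * (4 * e + 1)) := Nat.add_le_add_left step2 _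
    _ = _ := by ring

/-! ### The second moment bound for uncovered values of the last coordinate. -/

theorem even_sum_sub_sum {n : ℕ} (x : Fin n → ℤ) {c c' : Fin n → ℤ} (hc : c ∈ signVectors n)
    (hc' : c' ∈ signVectors n) : Even (∑ i, x i * c i - ∑ i, x i * c' i) := by
  rw [← Finset.sum_sub_distrib]
  refine Finset.even_sum _ fun i _ => ?_
  rw [← mul_sub]
  refine Even.mul_left ?_ _
  rcases mem_signVectors.1 hc i with h | h <;> rcases mem_signVectors.1 hc' i with h' | h' <;>
    rw [h, h'] <;> decide

/-- Chebyshev over the signs: the variance of x·c is at most nM², and a quotient beyond `J` forces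
|x·c| ≥ JM. -/
theorem card_filter_large_quotient_le {n M : ℕ} (hM : 0 < M) {J : ℤ} (hJ : 0 < J)
    {x : Fin n → ℤ} (hx : x ∈ intBox n M) :
    (((signVectors n).filter fun c => ¬ |(∑ i, x i * c i) / M| ≤ J).card : ℝ) ≤
      2 ^ n * n / (J : ℝ) ^ 2 := by
  have hM' : (0 : ℤ) < M := by exact_mod_cast hM
  have hMr : (0 : ℝ) < M := by exact_mod_cast hM
  have hJr : (0 : ℝ) < J := by exact_mod_cast hJ
  have h := sum_piFinset_sq_sum_le ({1, -1} : Finset ℤ) (fun (i : Fin n) y => (x i : ℝ) * y)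
    (fun _ => (M : ℝ) ^ 2) (by intro i; simp) (by
      intro i
      have h1 : (x i : ℝ) ^ 2 ≤ (M : ℝ) ^ 2 := by
        have := mem_intBox.1 hx i
        have h0 : (0 : ℝ) ≤ x i := by exact_mod_cast this.1
        have h2 : (x i : ℝ) ≤ M := by exact_mod_cast this.2.le
        gcongr
      simp
      linarith)
  rw [← signVectors] at h
  have hlow : ((signVectors n).filter fun c => ¬ |(∑ i, x i * c i) / M| ≤ J).card •
      ((J : ℝ) * M) ^ 2 ≤ ∑ c ∈ signVectors n, (∑ i, (x i : ℝ) * c i) ^ 2 := by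
    refine le_trans (Finset.card_nsmul_le_sum _ (fun c => (∑ i, (x i : ℝ) * c i) ^ 2) _ ?_)
      (Finset.sum_le_sum_of_subset_of_nonneg (Finset.filter_subset _ _) fun _ _ _ => sq_nonneg _)
    intro c hc
    have hc := (Finset.mem_filter.1 hc).2
    rw [not_le, lt_abs] at hc
    have habs : J * M ≤ |∑ i, x i * c i| := by
      rcases hc with hc | hc
      · have : J * M ≤ ∑ i, x i * c i := (Int.le_ediv_iff_mul_le hM').1 hc.le
        exact this.trans (le_abs_self _)
      · have : (∑ i, x i * c i) / M < -J := by linarith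
        rw [Int.ediv_lt_iff_lt_mul hM'] at this
        have h3 : J * M ≤ -∑ i, x i * c i := by linarith
        exact h3.trans (neg_le_abs _)
    have habs' : (J : ℝ) * M ≤ |∑ i, (x i : ℝ) * c i| := by exact_mod_cast habs
    rw [← sq_abs (∑ i, (x i : ℝ) * c i)]
    exact pow_le_pow_left₀ (by positivity) habs' 2
  rw [nsmul_eq_mul] at hlow
  simp only [Finset.sum_const, Finset.card_univ, Fintype.card_fin, nsmul_eq_mul] at h
  rw [Finset.card_pair (by norm_num)] at h
  rw [le_div_iff₀ (by positivity)]
  have h4 := hlow.trans h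
  push_cast at h4
  have : (((signVectors n).filter fun c => ¬ |(∑ i, x i * c i) / M| ≤ J).card : ℝ) * J ^ 2 *
      M ^ 2 ≤ 2 ^ n * n * M ^ 2 := by linarith
  exact le_of_mul_le_mul_right this (by positivity)

theorem card_pair_near_le {n : ℕ} (c : Fin n → ℤ) (hc : c ∈ signVectors n) :
    ((signVectors n).filter fun c' => ∀ b b', c b ≠ c' b → c b' ≠ c' b' → b = b').card ≤
      n + 1 := by
  have hsub : ((signVectors n).filter fun c' => ∀ b b', c b ≠ c' b → c b' ≠ c' b' → b = b') ⊆
      insert c (Finset.univ.image fun i => Function.update c i (-c i)) := by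
    intro c' h
    obtain ⟨hc', h⟩ := Finset.mem_filter.1 h
    rw [Finset.mem_insert, Finset.mem_image]
    by_cases hcc : c' = c
    · exact Or.inl hcc
    · right
      obtain ⟨b, hb⟩ := Function.ne_iff.1 hcc
      refine ⟨b, Finset.mem_univ _, funext fun i => ?_⟩
      by_cases hi : i = b
      · subst hi
        rw [Function.update_self]
        rcases mem_signVectors.1 hc i with h1 | h1 <;>
          rcases mem_signVectors.1 hc' i with h2 | h2 <;> simp_all
      · rw [Function.update_of_ne hi]
        by_contra hne
        exact hi (h i b hne (Ne.symm hb))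
  refine (Finset.card_le_card hsub).trans ((Finset.card_insert_le _ _).trans ?_)
  simpa using (Finset.card_image_le (s := Finset.univ) (f := fun i => Function.update c i (-c i)))

-- Pairs differing in at most one place, at most n + 1 for each `c`, are bounded trivially; all
-- others by the two-coordinate collision estimate.
open Classical in
theorem sum_collision_le {n M e : ℕ} (hM : 0 < M) (J t : ℤ) (r : ℤ → ℤ)
    (hr : ∀ j, |j| ≤ J → |r j + j * M - t| ≤ e) :
    (∑ c ∈ signVectors n, ∑ c' ∈ signVectors n,
      (((intBox n M).filter (Collision M J r c c')).card : ℝ)) ≤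
      2 ^ n * (M : ℝ) ^ n * ((n + 1) + 2 ^ n * ((2 * M + 3 * (4 * e + 1)) / (M : ℝ) ^ 2)) := by
  have hMr : (0 : ℝ) < M := by exact_mod_cast hM
  have key : ∀ c ∈ signVectors n, ∑ c' ∈ signVectors n,
      (((intBox n M).filter (Collision M J r c c')).card : ℝ) ≤
      (M : ℝ) ^ n * ((n + 1) + 2 ^ n * ((2 * M + 3 * (4 * e + 1)) / (M : ℝ) ^ 2)) := by
    intro c hc
    have hpt : ∀ c' ∈ signVectors n, (((intBox n M).filter (Collision M J r c c')).card : ℝ) ≤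
        (M : ℝ) ^ n * ((if ∀ b b', c b ≠ c' b → c b' ≠ c' b' → b = b' then 1 else 0) +
          (2 * M + 3 * (4 * e + 1)) / (M : ℝ) ^ 2) := by
      intro c' hc'
      split_ifs with hnear
      · have h1 : (((intBox n M).filter (Collision M J r c c')).card : ℝ) ≤ (M : ℝ) ^ n := by
          have := Finset.card_filter_le (intBox n M) (Collision M J r c c')
          rw [card_intBox] at this
          exact_mod_cast this
        refine h1.trans (le_mul_of_one_le_right (by positivity) ?_)
        have : (0 : ℝ) ≤ (2 * M + 3 * (4 * e + 1)) / (M : ℝ) ^ 2 := by positivity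
        linarith
      · push Not at hnear
        obtain ⟨b, b', hb, hb', hbb⟩ := hnear
        have h := sq_mul_card_collision_le hM J t r hr hc hc' hbb hb hb'
        have h' : (M : ℝ) * (M * (((intBox n M).filter (Collision M J r c c')).card : ℝ)) ≤
            (2 * M + 3 * (4 * e + 1)) * M ^ n := by exact_mod_cast h
        rw [zero_add, ← mul_div_assoc, le_div_iff₀ (by positivity)]
        linarith
    refine (Finset.sum_le_sum hpt).trans ?_
    rw [← Finset.mul_sum, Finset.sum_add_distrib, Finset.sum_const, card_signVectors,
      Finset.sum_boole, nsmul_eq_mul]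
    have hn : (((signVectors n).filter fun c' => ∀ b b', c b ≠ c' b → c b' ≠ c' b' →
        b = b').card : ℝ) ≤ n + 1 := by exact_mod_cast card_pair_near_le c hc
    push_cast
    gcongr
  refine (Finset.sum_le_sum key).trans ?_
  rw [Finset.sum_const, card_signVectors, nsmul_eq_mul]
  push_cast
  exact le_of_eq (by ring)

-- With N(y) the number of good `c` hitting y, an uncovered y contributes 1 to the sum of (1 -
-- l·N(y))². Expanding the square gives an exact first moment and a second moment controlled by
-- collisions; `l` is left free for later optimisation.
open Classical in
theorem card_uncovered_le {n M e : ℕ} (hM : 0 < M) (J τ : ℤ) (r : ℤ → ℤ)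
    (hr : ∀ j, |j| ≤ J → |r j + j * M - (τ - M + 1)| ≤ e)
    (hpar : ∀ j j', |j| ≤ J → |j'| ≤ J → Even (r j - r j')) (x : Fin n → ℤ) (l : ℝ) :
    (((Finset.Ico (0 : ℤ) M).filter fun y => ¬ ∃ c ∈ signVectors n, ∃ j, |j| ≤ J ∧
      (y + ∑ i, x i * c i + r j = τ ∨ y + ∑ i, x i * c i + r j = τ + 1)).card : ℝ) ≤
      M + 2 * e + 1
        - 4 * l * (((signVectors n).filter fun c => |(∑ i, x i * c i) / M| ≤ J).card : ℝ)
        + 2 * l ^ 2 * ∑ c ∈ signVectors n, ∑ c' ∈ signVectors n,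
          if Collision M J r c c' x then 1 else 0 := by
  have hM' : (0 : ℤ) < M := by exact_mod_cast hM
  set G := (signVectors n).filter fun c => |(∑ i, x i * c i) / M| ≤ J with hG
  -- A corrected sum is a residue in [0, M - 1] plus a number within e of τ - M + 1. This interval
  -- therefore contains both solutions y for every good `c`.
  set Y := Finset.Icc (-(e : ℤ)) (M + e) with hY
  let tot : (Fin n → ℤ) → ℤ := fun c => ∑ i, x i * c i + r ((∑ i, x i * c i) / M)
  let hit : (Fin n → ℤ) → ℤ → ℝ := fun c y => if y + tot c = τ ∨ y + tot c = τ + 1 then 1 else 0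
  have htot : ∀ c ∈ G, τ - M + 1 - e ≤ tot c ∧ tot c ≤ τ + e := by
    intro c hc
    have h1 := abs_le.1 (hr _ (Finset.mem_filter.1 hc).2)
    have h2 := Int.mul_ediv_add_emod (∑ i, x i * c i) M
    have h3 := Int.emod_nonneg (∑ i, x i * c i) hM'.ne'
    have h4 := Int.emod_lt_of_pos (∑ i, x i * c i) hM'
    simp only [tot]
    constructor <;> linarith
  have hpair : ∀ c, (Y.filter fun y => y + tot c = τ ∨ y + tot c = τ + 1) ⊆
      {τ - tot c, τ + 1 - tot c} := by
    intro c y hy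
    have := (Finset.mem_filter.1 hy).2
    simp only [Finset.mem_insert, Finset.mem_singleton]
    omega
  have hfirst : ∀ c ∈ G, ∑ y ∈ Y, hit c y = 2 := by
    intro c hc
    obtain ⟨h1, h2⟩ := htot c hc
    have : (Y.filter fun y => y + tot c = τ ∨ y + tot c = τ + 1) = {τ - tot c, τ + 1 - tot c} := by
      refine (hpair c).antisymm fun y hy => ?_
      simp only [Finset.mem_insert, Finset.mem_singleton] at hy
      simp only [hY, Finset.mem_filter, Finset.mem_Icc]
      omega
    simp only [hit]
    rw [Finset.sum_boole, this, Finset.card_pair (by omega)]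
    norm_num
  have hsecond : ∀ c ∈ G, ∀ c' ∈ G, ∑ y ∈ Y, hit c y * hit c' y ≤
      2 * if Collision M J r c c' x then 1 else 0 := by
    intro c hc c' hc'
    by_cases heq : tot c = tot c'
    · rw [if_pos ⟨(Finset.mem_filter.1 hc).2, (Finset.mem_filter.1 hc').2, heq⟩, mul_one,
        ← hfirst c hc]
      refine Finset.sum_le_sum fun y _ => ?_
      simp only [hit, ← heq]
      split_ifs <;> norm_num
    · refine le_trans (le_of_eq (Finset.sum_eq_zero fun y _ => ?_)) (by split_ifs <;> norm_num)
      -- Distinct corrected sums differ by an even number, hence by at least 2, so their pairs of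
      -- solutions are disjoint.
      have he : Even (tot c - tot c') := by
        have h1 := even_sum_sub_sum x (Finset.mem_filter.1 hc).1 (Finset.mem_filter.1 hc').1
        have h2 := hpar _ _ (Finset.mem_filter.1 hc).2 (Finset.mem_filter.1 hc').2
        obtain ⟨v, hv⟩ := h1.add h2
        exact ⟨v, by simp only [tot]; linarith⟩
      obtain ⟨w, hw⟩ := he
      simp only [hit, mul_ite, mul_one, mul_zero]
      split_ifs with ha hb
      · omega
      · rfl
      · rfl
  have hcover : (((Finset.Ico (0 : ℤ) M).filter fun y => ¬ ∃ c ∈ signVectors n, ∃ j, |j| ≤ J ∧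
      (y + ∑ i, x i * c i + r j = τ ∨ y + ∑ i, x i * c i + r j = τ + 1)).card : ℝ) ≤
      ∑ y ∈ Y, (1 - l * ∑ c ∈ G, hit c y) ^ 2 := by
    rw [Finset.cast_card]
    refine le_trans (Finset.sum_le_sum (g := fun y => (1 - l * ∑ c ∈ G, hit c y) ^ 2) ?_)
      (Finset.sum_le_sum_of_subset_of_nonneg ?_ fun _ _ _ => sq_nonneg _)
    · intro y hy
      have hz : ∑ c ∈ G, hit c y = 0 := by
        refine Finset.sum_eq_zero fun c hc => if_neg fun h => (Finset.mem_filter.1 hy).2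
          ⟨c, (Finset.mem_filter.1 hc).1, _, (Finset.mem_filter.1 hc).2, ?_⟩
        simpa only [tot, add_assoc] using h
      simp [hz]
    · intro y hy
      have := Finset.mem_Ico.1 (Finset.mem_filter.1 hy).1
      simp only [hY, Finset.mem_Icc]
      omega
  have hexp : ∑ y ∈ Y, (1 - l * ∑ c ∈ G, hit c y) ^ 2 =
      Y.card - 2 * l * ∑ c ∈ G, ∑ y ∈ Y, hit c y +
        l ^ 2 * ∑ c ∈ G, ∑ c' ∈ G, ∑ y ∈ Y, hit c y * hit c' y := by
    have h1 : ∑ c ∈ G, ∑ c' ∈ G, ∑ y ∈ Y, hit c y * hit c' y =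
        ∑ y ∈ Y, (∑ c ∈ G, hit c y) ^ 2 := by
      simp_rw [pow_two, Finset.sum_mul_sum]
      rw [Finset.sum_comm (s := Y)]
      exact Finset.sum_congr rfl fun c _ => Finset.sum_comm
    rw [h1, Finset.sum_comm (s := G), Finset.mul_sum, Finset.mul_sum, Finset.cast_card,
      ← Finset.sum_sub_distrib, ← Finset.sum_add_distrib]
    exact Finset.sum_congr rfl fun y _ => by ring
  have hYc : (Y.card : ℝ) = M + 2 * e + 1 := by
    have : (Y.card : ℤ) = M + 2 * e + 1 := by
      simp only [hY, Int.card_Icc]; omega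
    exact_mod_cast this
  have hs2 : ∑ c ∈ G, ∑ c' ∈ G, ∑ y ∈ Y, hit c y * hit c' y ≤
      2 * ∑ c ∈ signVectors n, ∑ c' ∈ signVectors n,
        if Collision M J r c c' x then (1 : ℝ) else 0 := by
    have hpos : ∀ c c' : Fin n → ℤ, (0 : ℝ) ≤ if Collision M J r c c' x then (1 : ℝ) else 0 := by
      intro c c'; split_ifs <;> norm_num
    rw [Finset.mul_sum]
    refine (Finset.sum_le_sum fun c hc => ?_).trans (Finset.sum_le_sum_of_subset_of_nonneg
      (Finset.filter_subset _ _) fun c _ _ =>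
        mul_nonneg zero_le_two (Finset.sum_nonneg fun c' _ => hpos c c'))
    rw [Finset.mul_sum]
    refine (Finset.sum_le_sum fun c' hc' => hsecond c hc c' hc').trans
      (Finset.sum_le_sum_of_subset_of_nonneg
      (Finset.filter_subset _ _) fun c' _ _ => mul_nonneg zero_le_two (hpos c c'))
  have hs1 : ∑ c ∈ G, ∑ y ∈ Y, hit c y = 2 * G.card := by
    rw [Finset.sum_congr rfl hfirst, Finset.sum_const, nsmul_eq_mul, mul_comm]
  rw [hexp, hs1, hYc] at hcover
  have := mul_le_mul_of_nonneg_left hs2 (sq_nonneg l)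
  linarith

open Classical in
theorem sum_card_uncovered_le {n M e : ℕ} (hM : 0 < M) {J : ℤ} (hJ : 0 < J) (τ : ℤ) (r : ℤ → ℤ)
    (hr : ∀ j, |j| ≤ J → |r j + j * M - (τ - M + 1)| ≤ e)
    (hpar : ∀ j j', |j| ≤ J → |j'| ≤ J → Even (r j - r j')) :
    (∑ x ∈ intBox n M, ((Finset.Ico (0 : ℤ) M).filter fun y =>
      ¬ ∃ c ∈ signVectors n, ∃ j, |j| ≤ J ∧
      (y + ∑ i, x i * c i + r j = τ ∨ y + ∑ i, x i * c i + r j = τ + 1)).card : ℝ) ≤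
      (M : ℝ) ^ n * ((2 * e + 1) + 2 * M * n / (J : ℝ) ^ 2 + (M : ℝ) ^ 2 * (n + 1) / (2 * 2 ^ n)
        + 3 * (4 * e + 1) / 2) := by
  have hMr : (0 : ℝ) < M := by exact_mod_cast hM
  have hJr : (0 : ℝ) < J := by exact_mod_cast hJ
  -- This is the reciprocal of the heuristic mean 2·2^n/M of N(y). The main terms become M - 2M + M
  -- = 0.
  set l : ℝ := M / (2 * 2 ^ n) with hl
  have hpt : ∀ x ∈ intBox n M, (((Finset.Ico (0 : ℤ) M).filter fun y =>
      ¬ ∃ c ∈ signVectors n, ∃ j, |j| ≤ J ∧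
      (y + ∑ i, x i * c i + r j = τ ∨ y + ∑ i, x i * c i + r j = τ + 1)).card : ℝ) ≤
      (M + 2 * e + 1 - 4 * l * (2 ^ n - 2 ^ n * n / (J : ℝ) ^ 2)) +
        2 * l ^ 2 * ∑ c ∈ signVectors n, ∑ c' ∈ signVectors n,
          if Collision M J r c c' x then 1 else 0 := by
    intro x hx
    refine (card_uncovered_le hM J τ r hr hpar x l).trans ?_
    have h1 := card_filter_large_quotient_le hM hJ hx
    have h2 := Finset.card_filter_add_card_filter_not (s := signVectors n)
      (fun c => |(∑ i, x i * c i) / M| ≤ J)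
    rw [card_signVectors] at h2
    have h2' : (((signVectors n).filter fun c => |(∑ i, x i * c i) / M| ≤ J).card : ℝ) +
        (((signVectors n).filter fun c => ¬ |(∑ i, x i * c i) / M| ≤ J).card : ℝ) = 2 ^ n := by
      exact_mod_cast h2
    gcongr
    linarith
  refine (Finset.sum_le_sum hpt).trans ?_
  rw [Finset.sum_add_distrib, Finset.sum_const, card_intBox, ← Finset.mul_sum, nsmul_eq_mul]
  have hswap : ∑ x ∈ intBox n M, ∑ c ∈ signVectors n, ∑ c' ∈ signVectors n,
      (if Collision M J r c c' x then (1 : ℝ) else 0) =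
      ∑ c ∈ signVectors n, ∑ c' ∈ signVectors n,
        (((intBox n M).filter (Collision M J r c c')).card : ℝ) := by
    rw [Finset.sum_comm]
    refine Finset.sum_congr rfl fun c _ => ?_
    rw [Finset.sum_comm]
    exact Finset.sum_congr rfl fun c' _ => Finset.sum_boole _ _
  rw [hswap]
  have h3 := mul_le_mul_of_nonneg_left (sum_collision_le (n := n) hM J _ r hr)
    (by positivity : (0 : ℝ) ≤ 2 * l ^ 2)
  refine (add_le_add_right h3 _).trans (le_of_eq ?_)
  rw [hl]
  push_cast
  field_simp
  ring

/-! ### Steering a signed sum towards a prescribed target. -/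

/-- Greedy choice of signs: the sum can be steered to within the largest step of the target. -/
theorem exists_sign_sum_near {ι : Type*} [DecidableEq ι] (x : ι → ℤ) {B : ℝ}
    (S : Finset ι) (hx : ∀ i ∈ S, 0 ≤ x i ∧ (x i : ℝ) ≤ B) :
    ∀ t : ℝ, |t| ≤ ∑ i ∈ S, (x i : ℝ) + B →
      ∃ c : ι → ℤ, (∀ i, c i = 1 ∨ c i = -1) ∧ |∑ i ∈ S, (x i : ℝ) * c i - t| ≤ B := by
  induction S using Finset.induction_on with
  | empty =>
    intro t ht
    exact ⟨fun _ => 1, fun _ => Or.inl rfl, by simpa using ht⟩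
  | insert a S ha ih =>
    intro t ht
    have hx' : ∀ i ∈ S, 0 ≤ x i ∧ (x i : ℝ) ≤ B := fun i hi => hx i (Finset.mem_insert_of_mem hi)
    obtain ⟨ha0, haB⟩ := hx a (Finset.mem_insert_self _ _)
    have ha0' : (0 : ℝ) ≤ x a := by exact_mod_cast ha0
    have hS : 0 ≤ ∑ i ∈ S, (x i : ℝ) :=
      Finset.sum_nonneg fun i hi => by exact_mod_cast (hx' i hi).1
    rw [Finset.sum_insert ha, abs_le] at ht
    have hstep : ∃ s : ℤ, (s = 1 ∨ s = -1) ∧ |t - x a * s| ≤ ∑ i ∈ S, (x i : ℝ) + B := by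
      rcases le_total 0 t with h | h
      · exact ⟨1, Or.inl rfl, by rw [abs_le]; push_cast; constructor <;> linarith⟩
      · exact ⟨-1, Or.inr rfl, by rw [abs_le]; push_cast; constructor <;> linarith⟩
    obtain ⟨s, hs, hst⟩ := hstep
    obtain ⟨c, hc, hct⟩ := ih hx' _ hst
    refine ⟨Function.update c a s, fun i => ?_, ?_⟩
    · by_cases hi : i = a
      · subst hi; simpa using hs
      · simpa [hi] using hc i
    · rw [Finset.sum_insert ha, Function.update_self]
      have : ∑ i ∈ S, (x i : ℝ) * (Function.update c a s i : ℤ) = ∑ i ∈ S, (x i : ℝ) * c i :=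
        Finset.sum_congr rfl fun i hi => by
          have hne : i ≠ a := fun h => ha (h ▸ hi)
          rw [Function.update_of_ne hne]
      rw [this]
      refine le_of_eq_of_le ?_ hct
      congr 1; ring

/-- Two greedy stages: the coordinates outside `S` come within `M` of the target, then the small
coordinates in `S`, whose total is at least `M`, reduce the error to `B`. -/
theorem exists_signVector_sum_near {k M : ℕ} {x : Fin k → ℤ} (hx : x ∈ intBox k M) {B : ℝ}
    (hB : 0 ≤ B) (S : Finset (Fin k)) (hS : ∀ i ∈ S, (x i : ℝ) ≤ B)
    (hM : (M : ℝ) ≤ ∑ i ∈ S, (x i : ℝ)) {t : ℝ} (ht : |t| ≤ ∑ i ∈ Sᶜ, (x i : ℝ)) :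
    ∃ c ∈ signVectors k, |∑ i, (x i : ℝ) * c i - t| ≤ B := by
  have hx := mem_intBox.1 hx
  have hM0 : (0 : ℝ) ≤ M := Nat.cast_nonneg M
  obtain ⟨c, hc, hct⟩ := exists_sign_sum_near x (B := M) Sᶜ
    (fun i _ => ⟨(hx i).1, by exact_mod_cast (hx i).2.le⟩) t (by linarith)
  obtain ⟨d, hd, hdt⟩ := exists_sign_sum_near x S (fun i hi => ⟨(hx i).1, hS i hi⟩)
    (t - ∑ i ∈ Sᶜ, (x i : ℝ) * c i) (by rw [abs_sub_comm]; linarith)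
  refine ⟨fun i => if i ∈ S then d i else c i, mem_signVectors.2 fun i => ?_, ?_⟩
  · by_cases hi : i ∈ S
    · simpa [hi] using hd i
    · simpa [hi] using hc i
  · rw [← Finset.sum_add_sum_compl S]
    have e1 : ∑ i ∈ S, (x i : ℝ) * ((if i ∈ S then d i else c i : ℤ) : ℝ) =
        ∑ i ∈ S, (x i : ℝ) * d i :=
      Finset.sum_congr rfl fun i hi => by rw [if_pos hi]
    have e2 : ∑ i ∈ Sᶜ, (x i : ℝ) * ((if i ∈ S then d i else c i : ℤ) : ℝ) =
        ∑ i ∈ Sᶜ, (x i : ℝ) * c i :=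
      Finset.sum_congr rfl fun i hi => by rw [if_neg (Finset.mem_compl.1 hi)]
    rw [e1, e2]
    refine le_of_eq_of_le ?_ hdt
    congr 1; ring

theorem exists_signVector_sum_near_of_card {k M : ℕ} {x : Fin k → ℤ} (hx : x ∈ intBox k M)
    {B q : ℕ} {a : ℝ} (ha : a ≤ ((Finset.univ.filter fun i => (M : ℤ) ≤ 2 * x i).card : ℝ))
    (hq : q ≤ (Finset.univ.filter fun i => (B : ℤ) ≤ 2 * x i ∧ x i ≤ B).card)
    (hqB : 2 * M ≤ q * B) {t : ℝ} (ht : |t| ≤ (a / 2 - q) * M) :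
    ∃ c ∈ signVectors k, |∑ i, (x i : ℝ) * c i - t| ≤ B := by
  have hx' := mem_intBox.1 hx
  obtain ⟨S, hS, hSq⟩ := Finset.exists_subset_card_eq hq
  have hS' : ∀ i ∈ S, (B : ℤ) ≤ 2 * x i ∧ x i ≤ B := fun i hi => (Finset.mem_filter.1 (hS hi)).2
  refine exists_signVector_sum_near hx (Nat.cast_nonneg B) S
    (fun i hi => by exact_mod_cast (hS' i hi).2) ?_ ?_
  · have h := Finset.card_nsmul_le_sum S (fun i => (x i : ℝ)) (B / 2) (fun i hi => by
      have : (B : ℝ) ≤ 2 * x i := by exact_mod_cast (hS' i hi).1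
      linarith)
    rw [hSq, nsmul_eq_mul] at h
    have : (2 : ℝ) * M ≤ q * B := by exact_mod_cast hqB
    linarith
  · have h1 : ∑ i ∈ S, (x i : ℝ) ≤ q * M := by
      have h := Finset.sum_le_card_nsmul S (fun i => (x i : ℝ)) M
        (fun i _ => by exact_mod_cast (hx' i).2.le)
      rwa [hSq, nsmul_eq_mul] at h
    have h2 : a * (M / 2) ≤ ∑ i, (x i : ℝ) := by
      have h := Finset.card_nsmul_le_sum (Finset.univ.filter fun i => (M : ℤ) ≤ 2 * x i)
        (fun i => (x i : ℝ)) (M / 2) (fun i hi => by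
          have : (M : ℝ) ≤ 2 * x i := by exact_mod_cast (Finset.mem_filter.1 hi).2
          linarith)
      rw [nsmul_eq_mul] at h
      have h3 : a * ((M : ℝ) / 2) ≤ _ := mul_le_mul_of_nonneg_right ha (by positivity)
      refine h3.trans (h.trans ?_)
      exact Finset.sum_le_sum_of_subset_of_nonneg (Finset.filter_subset _ _)
        fun i _ _ => by exact_mod_cast (hx' i).1
    have h3 := Finset.sum_add_sum_compl S fun i => (x i : ℝ)
    linarith

/-- Chebyshev's inequality for the number of coordinates in a prescribed set. -/
theorem card_filter_few_coordinates_le {k M : ℕ} (hk : 0 < k) (hM : 0 < M) (I : Finset ℤ)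
    (hI : I ⊆ Finset.Ico (0 : ℤ) M) {p : ℝ} (hp : 0 < p) (hpI : p * M ≤ I.card) :
    (((intBox k M).filter fun x =>
      ((Finset.univ.filter fun i => x i ∈ I).card : ℝ) < p * k / 2).card : ℝ) ≤
      (M : ℝ) ^ k * (4 / (p * k)) := by
  set F := (intBox k M).filter fun x =>
    ((Finset.univ.filter fun i => x i ∈ I).card : ℝ) < p * k / 2 with hF
  have hFsub : F ⊆ intBox k M := Finset.filter_subset _ _
  have hMr : (0 : ℝ) < M := by exact_mod_cast hM
  have hkr : (0 : ℝ) < k := by exact_mod_cast hk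
  set ρ : ℝ := I.card / M with hρ
  have hpρ : p ≤ ρ := by rw [hρ, le_div_iff₀ hMr]; exact hpI
  have hρ0 : 0 < ρ := hp.trans_le hpρ
  have hsum : ∑ y ∈ Finset.Ico (0 : ℤ) M, (if y ∈ I then (1 : ℝ) else 0) = ρ * M := by
    rw [Finset.sum_boole, Finset.filter_mem_eq_inter, Finset.inter_eq_right.2 hI, hρ,
      div_mul_cancel₀ _ hMr.ne']
  have hcard : ((Finset.Ico (0 : ℤ) M).card : ℝ) = M := by simp
  have h := sum_piFinset_sq_sum_le (Finset.Ico (0 : ℤ) M)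
    (fun (_ : Fin k) y => (if y ∈ I then (1 : ℝ) else 0) - ρ) (fun _ => ρ)
    (fun _ => by
      rw [Finset.sum_sub_distrib, hsum, Finset.sum_const, nsmul_eq_mul, hcard]; ring)
    (fun _ => by
      have : ∀ y, ((if y ∈ I then (1 : ℝ) else 0) - ρ) ^ 2 =
          (1 - 2 * ρ) * (if y ∈ I then (1 : ℝ) else 0) + ρ ^ 2 := by
        intro y; split_ifs <;> ring
      simp_rw [this]
      rw [Finset.sum_add_distrib, ← Finset.mul_sum, hsum, Finset.sum_const, nsmul_eq_mul, hcard]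
      nlinarith [mul_nonneg hMr.le (sq_nonneg ρ)])
  rw [← intBox] at h
  set g : (Fin k → ℤ) → ℝ := fun x =>
    (∑ i, ((if x i ∈ I then (1 : ℝ) else 0) - ρ)) ^ 2 with hg
  have hlow : (F.card : ℝ) * (ρ * k / 2) ^ 2 ≤ ∑ x ∈ intBox k M, g x := by
    rw [← nsmul_eq_mul]
    refine le_trans (Finset.card_nsmul_le_sum F g _ ?_)
      (Finset.sum_le_sum_of_subset_of_nonneg hFsub fun x _ _ => sq_nonneg _)
    intro x hx
    have hx := (Finset.mem_filter.1 hx).2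
    have hpk : p * k ≤ ρ * k := by gcongr
    simp only [hg]
    rw [Finset.sum_sub_distrib, Finset.sum_boole, Finset.sum_const, nsmul_eq_mul,
      Finset.card_univ, Fintype.card_fin, ← neg_sq (_ - _)]
    exact pow_le_pow_left₀ (by positivity) (by linarith) 2
  simp only [Finset.sum_const, Finset.card_univ, Fintype.card_fin, nsmul_eq_mul, hcard] at h
  have h2 := hlow.trans h
  have h3 : (F.card : ℝ) ≤
      (M : ℝ) ^ k * (4 / (ρ * k)) := by
    have : (M : ℝ) ^ k * (4 / (ρ * k)) = (M : ℝ) ^ k * (k * ρ) / (ρ * k / 2) ^ 2 := by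
      field_simp; ring
    rw [this, le_div_iff₀ (by positivity)]
    exact h2
  refine h3.trans ?_
  gcongr

/-- Every target of moderate size is a signed sum of the coordinates of `x`, up to error `B`. -/
def Steerable {k : ℕ} (B : ℕ) (R : ℝ) (x : Fin k → ℤ) : Prop :=
  ∀ t : ℝ, |t| ≤ R → ∃ c ∈ signVectors k, |∑ i, (x i : ℝ) * c i - t| ≤ B

-- A typical vector has at least k/6 coordinates of size at least M/2, which give the range, and at
-- least 4D coordinates in [B/2, B], which give the precision. Each property fails with small
-- probability by Chebyshev.
open Classical in
theorem card_not_steerable_le {k M D : ℕ} (hM : 2 ≤ M) (hD : 2 ≤ D) (hk : 32 * D ^ 2 ≤ k) :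
    (((intBox k M).filter fun x =>
      ¬ Steerable (max 1 (M / D)) (((k : ℝ) / 12 - 4 * D) * M) x).card : ℝ) ≤
      (M : ℝ) ^ k * (28 * D / k) := by
  set B := max 1 (M / D) with hB
  have hD0 : 0 < D := by omega
  have hk0 : 0 < k := by
    have : 0 < 32 * D ^ 2 := by positivity
    omega
  have hB1 : 1 ≤ B := le_max_left _ _
  have hBM : B < M := max_lt (by omega) (Nat.div_lt_self (by omega) (by omega))
  have hMB : M ≤ 2 * D * B := by
    have h1 : M < D * (M / D) + D := by
      simpa [Nat.mul_add] using Nat.lt_mul_div_succ M hD0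
    have h2 : D * (M / D) ≤ D * B := Nat.mul_le_mul_left _ (le_max_right _ _)
    have h3 : D * 1 ≤ D * B := Nat.mul_le_mul_left _ hB1
    nlinarith
  have hDr : (0 : ℝ) < D := by exact_mod_cast hD0
  have hkr : (0 : ℝ) < k := by exact_mod_cast hk0
  have hkD : (32 : ℝ) * D ^ 2 ≤ k := by exact_mod_cast hk
  -- The proportion 1/3 is attained at M = 3, where only the value 2 counts.
  have hA := card_filter_few_coordinates_le hk0 (by omega : 0 < M)
    ((Finset.Ico (0 : ℤ) M).filter fun y => (M : ℤ) ≤ 2 * y) (Finset.filter_subset _ _)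
    (p := 1 / 3) (by norm_num) (by
      have h : ((M : ℤ) - (M + 1) / 2).toNat ≤
          ((Finset.Ico (0 : ℤ) M).filter fun y => (M : ℤ) ≤ 2 * y).card := by
        rw [← Int.card_Ico]
        refine Finset.card_le_card fun y hy => ?_
        simp only [Finset.mem_Ico, Finset.mem_filter] at hy ⊢
        omega
      have h2 : M ≤ 3 * ((Finset.Ico (0 : ℤ) M).filter fun y => (M : ℤ) ≤ 2 * y).card := by omega
      have h3 : (M : ℝ) ≤ 3 * (((Finset.Ico (0 : ℤ) M).filter
        fun y => (M : ℤ) ≤ 2 * y).card : ℝ) := by exact_mod_cast h2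
      linarith)
  -- At least B/2 integers qualify, and B ≥ M/(2D).
  have hC := card_filter_few_coordinates_le hk0 (by omega : 0 < M)
    ((Finset.Ico (0 : ℤ) M).filter fun y => (B : ℤ) ≤ 2 * y ∧ y ≤ B) (Finset.filter_subset _ _)
    (p := 1 / (4 * D)) (by positivity) (by
      have h : ((B : ℤ) + 1 - (B + 1) / 2).toNat ≤
          ((Finset.Ico (0 : ℤ) M).filter fun y => (B : ℤ) ≤ 2 * y ∧ y ≤ B).card := by
        rw [← Int.card_Icc]
        refine Finset.card_le_card fun y hy => ?_
        simp only [Finset.mem_Ico, Finset.mem_Icc, Finset.mem_filter] at hy ⊢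
        omega
      have h2 : B ≤ 2 * ((Finset.Ico (0 : ℤ) M).filter
        fun y => (B : ℤ) ≤ 2 * y ∧ y ≤ B).card := by omega
      have h3 : (B : ℝ) ≤ 2 * (((Finset.Ico (0 : ℤ) M).filter
        fun y => (B : ℤ) ≤ 2 * y ∧ y ≤ B).card : ℝ) := by exact_mod_cast h2
      have h4 : (M : ℝ) ≤ 2 * D * B := by exact_mod_cast hMB
      rw [one_div, inv_mul_le_iff₀ (by positivity)]
      nlinarith)
  have hsub : ((intBox k M).filter fun x =>
      ¬ Steerable B (((k : ℝ) / 12 - 4 * D) * M) x) ⊆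
      ((intBox k M).filter fun x => ((Finset.univ.filter fun i => x i ∈
        (Finset.Ico (0 : ℤ) M).filter fun y => (M : ℤ) ≤ 2 * y).card : ℝ) < 1 / 3 * k / 2) ∪
      ((intBox k M).filter fun x => ((Finset.univ.filter fun i => x i ∈
        (Finset.Ico (0 : ℤ) M).filter fun y => (B : ℤ) ≤ 2 * y ∧ y ≤ B).card : ℝ) <
          1 / (4 * D) * k / 2) := by
    intro x hx
    obtain ⟨hx, hns⟩ := Finset.mem_filter.1 hx
    by_contra hcon
    rw [Finset.mem_union, not_or, Finset.mem_filter, Finset.mem_filter] at hcon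
    obtain ⟨h1, h2⟩ := hcon
    have h1 := not_lt.1 fun h => h1 ⟨hx, h⟩
    have h2 := not_lt.1 fun h => h2 ⟨hx, h⟩
    refine hns fun t ht => exists_signVector_sum_near_of_card hx (q := 4 * D)
      (h1.trans ?_) ?_ (by nlinarith) (ht.trans (le_of_eq (by push_cast; ring)))
    · exact_mod_cast Finset.card_le_card fun i hi => by
        simp only [Finset.mem_filter] at hi ⊢
        exact ⟨hi.1, hi.2.2⟩
    · have h3 : ((4 * D : ℕ) : ℝ) ≤ 1 / (4 * D) * k / 2 := by
        push_cast
        rw [one_div, le_div_iff₀ two_pos, le_inv_mul_iff₀ (by positivity)]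
        linarith
      have h4 := Nat.cast_le.1 (h3.trans h2)
      refine h4.trans (Finset.card_le_card fun i hi => ?_)
      simp only [Finset.mem_filter] at hi ⊢
      exact ⟨hi.1, hi.2.2⟩
  have hle := (Finset.card_le_card hsub).trans (Finset.card_union_le _ _)
  have hle' := (Nat.cast_le (α := ℝ)).2 hle
  push_cast at hle' hA hC
  refine hle'.trans ((add_le_add hA hC).trans ?_)
  rw [← mul_add]
  refine mul_le_mul_of_nonneg_left ?_ (by positivity)
  have hD1 : (1 : ℝ) ≤ D := by exact_mod_cast hD0
  have e1 : 4 / (1 / 3 * (k : ℝ)) = 12 / k := by field_simp; norm_num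
  have e2 : 4 / (1 / (4 * D) * (k : ℝ)) = 16 * D / k := by field_simp; norm_num
  rw [e1, e2, ← add_div]
  gcongr
  linarith

/-! ### Splitting the coordinates and combining the estimates. -/

theorem one_sub_solutionProb_coeffSet_one {n M : ℕ} (hM : 0 < M) (τ : ℤ) :
    1 - solutionProb n M (coeffSet 1) {τ, τ + 1} =
      ((intBox n M).filter fun x => ¬ ∃ c ∈ signVectors n,
        (∑ i, x i * c i = τ ∨ ∑ i, x i * c i = τ + 1)).card / (M : ℝ) ^ n := by
  have hMr : (0 : ℝ) < (M : ℝ) ^ n := by positivity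
  have h := Finset.card_filter_add_card_filter_not (s := intBox n M)
    (fun x => ∃ c ∈ signVectors n, (∑ i, x i * c i = τ ∨ ∑ i, x i * c i = τ + 1))
  rw [card_intBox] at h
  have h' : (((intBox n M).filter fun x => ∃ c ∈ signVectors n,
        (∑ i, x i * c i = τ ∨ ∑ i, x i * c i = τ + 1)).card : ℝ) +
      (((intBox n M).filter fun x => ¬ ∃ c ∈ signVectors n,
        (∑ i, x i * c i = τ ∨ ∑ i, x i * c i = τ + 1)).card : ℝ) = (M : ℝ) ^ n := by
    exact_mod_cast h
  rw [solutionProb_coeffSet_one, eq_div_iff hMr.ne', sub_mul, div_mul_cancel₀ _ hMr.ne']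
  linarith

theorem one_sub_solutionProb_le_of_lt {n M D : ℕ} (hM : 2 ≤ M) (hMD : M < D) (hn : 32 * D ^ 2 ≤ n)
    {τ : ℤ} (hτ : |(τ : ℝ)| + 1 ≤ ((n : ℝ) / 12 - 4 * D) * M) :
    1 - solutionProb n M (coeffSet 1) {τ, τ + 1} ≤ 28 * D / n := by
  classical
  have hMr : (0 : ℝ) < (M : ℝ) ^ n := by positivity
  rw [one_sub_solutionProb_coeffSet_one (by omega), div_le_iff₀ hMr]
  have h := card_not_steerable_le hM (by omega : 2 ≤ D) hn
  rw [Nat.div_eq_of_lt hMD] at h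
  rw [mul_comm]
  refine le_trans ?_ h
  refine Nat.cast_le.2 (Finset.card_le_card fun x hx => ?_)
  obtain ⟨hx, hbad⟩ := Finset.mem_filter.1 hx
  refine Finset.mem_filter.2 ⟨hx, fun hs => hbad ?_⟩
  -- The steering error is 1 since M / D = 0, and the only integers within 1 of τ + 1/2 are τ and τ
  -- + 1.
  obtain ⟨c, hc, hct⟩ := hs (τ + 1 / 2) ((abs_add_le _ _).trans (by
    rw [abs_of_pos (by norm_num : (0 : ℝ) < 1 / 2)]; linarith))
  refine ⟨c, hc, ?_⟩
  rw [abs_le] at hct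
  norm_num at hct
  have h1 : (τ : ℝ) - 1 < (∑ i, x i * c i : ℤ) := by push_cast; linarith
  have h2 : ((∑ i, x i * c i : ℤ) : ℝ) < τ + 2 := by push_cast; linarith
  have h1' : τ - 1 < ∑ i, x i * c i := by exact_mod_cast h1
  have h2' : ∑ i, x i * c i < τ + 2 := by exact_mod_cast h2
  omega

/-- A sign vector for which the split sum `y + u · c + w · d` hits `{τ, τ + 1}`. -/
def SplitSolvable {m k : ℕ} (τ : ℤ) (w : Fin k → ℤ) (u : Fin m → ℤ) (y : ℤ) : Prop :=
  ∃ c ∈ signVectors m, ∃ d ∈ signVectors k,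
    (y + ∑ i, u i * c i + ∑ i, w i * d i = τ ∨ y + ∑ i, u i * c i + ∑ i, w i * d i = τ + 1)

open Classical in
theorem card_unsolvable_le_sum_split (m k M : ℕ) (τ : ℤ) :
    ((intBox (m + k + 1) M).filter fun x => ¬ ∃ c ∈ signVectors (m + k + 1),
      (∑ i, x i * c i = τ ∨ ∑ i, x i * c i = τ + 1)).card ≤
    ∑ w ∈ intBox k M, ∑ u ∈ intBox m M,
      ((Finset.Ico (0 : ℤ) M).filter fun y => ¬ SplitSolvable τ w u y).card := by
  have hcard : ∑ w ∈ intBox k M, ∑ u ∈ intBox m M,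
      ((Finset.Ico (0 : ℤ) M).filter fun y => ¬ SplitSolvable τ w u y).card =
      ((intBox k M ×ˢ intBox m M ×ˢ Finset.Ico (0 : ℤ) M).filter
        fun p => ¬ SplitSolvable τ p.1 p.2.1 p.2.2).card := by
    simp_rw [Finset.card_filter]
    rw [Finset.sum_product]
    exact Finset.sum_congr rfl fun w _ => by rw [Finset.sum_product]
  rw [hcard]
  refine Finset.card_le_card_of_injOn (fun x => (fun i => x (Fin.natAdd m i).succ,
    fun i => x (Fin.castAdd k i).succ, x 0)) ?_ ?_
  · intro x hx
    obtain ⟨hx, hbad⟩ := Finset.mem_filter.1 hx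
    have hx := mem_intBox.1 hx
    simp only [Finset.coe_filter, Finset.mem_product, mem_intBox, Finset.mem_Ico]
    refine ⟨⟨fun i => hx _, fun i => hx _, hx _⟩, fun ⟨c, hc, d, hd, h⟩ => hbad ?_⟩
    refine ⟨Fin.cons 1 (Fin.append c d), mem_signVectors.2 fun i => ?_, ?_⟩
    · refine Fin.cases (by simp) (fun i => ?_) i
      refine Fin.addCases (fun i => ?_) (fun i => ?_) i
      · simpa using mem_signVectors.1 hc i
      · simpa using mem_signVectors.1 hd i
    · simpa [Fin.sum_univ_succ, Fin.sum_univ_add, add_assoc] using h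
  · intro x _ x' _ h
    simp only [Prod.mk.injEq] at h
    funext i
    refine Fin.cases h.2.2 (fun i => ?_) i
    refine Fin.addCases (fun i => ?_) (fun i => ?_) i
    · exact congrFun h.2.1 i
    · exact congrFun h.1 i

-- Steerability of `w` supplies the corrections r(j) = w·d_j. They have a common parity because all
-- come from the same `w`.
open Classical in
theorem sum_card_split_unsolvable_le_of_steerable {m k M e : ℕ} (hM : 0 < M) {J : ℤ} (hJ : 0 < J)
    (τ : ℤ) {R : ℝ} (hR : |(τ : ℝ)| + (J + 1) * M ≤ R) {w : Fin k → ℤ} (hw : Steerable e R w) :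
    ((∑ u ∈ intBox m M, ((Finset.Ico (0 : ℤ) M).filter
      fun y => ¬ SplitSolvable τ w u y).card : ℕ) : ℝ) ≤
      (M : ℝ) ^ m * ((2 * e + 1) + 2 * M * m / (J : ℝ) ^ 2 + (M : ℝ) ^ 2 * (m + 1) / (2 * 2 ^ m)
        + 3 * (4 * e + 1) / 2) := by
  have hM1 : (1 : ℝ) ≤ M := by exact_mod_cast hM
  have hex : ∀ j : ℤ, ∃ d ∈ signVectors k,
      |j| ≤ J → |∑ i, w i * d i + j * M - (τ - M + 1)| ≤ e := by
    intro j
    by_cases hj : |j| ≤ J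
    · have hj' : |(j : ℝ)| ≤ J := by exact_mod_cast hj
      obtain ⟨d, hd, h⟩ := hw ((τ : ℝ) - M + 1 - j * M) (by
        have h1 : |(j : ℝ) * M| ≤ J * M := by
          rw [abs_mul, abs_of_pos (by linarith : (0 : ℝ) < M)]
          gcongr
        have h2 := abs_le.1 h1
        have h3 := abs_le.1 (le_refl |(τ : ℝ)|)
        rw [abs_le]
        constructor <;> linarith)
      refine ⟨d, hd, fun _ => ?_⟩
      have h4 : ((|∑ i, w i * d i + j * M - (τ - M + 1)| : ℤ) : ℝ) ≤ (e : ℤ) := by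
        push_cast
        refine le_of_eq_of_le ?_ h
        congr 1; ring
      exact_mod_cast h4
    -- An arbitrary value outside the range, so that `d` is defined for every integer.
    · exact ⟨fun _ => 1, mem_signVectors.2 fun _ => Or.inl rfl, fun h => absurd h hj⟩
  choose d hd hdr using hex
  refine le_trans ?_ (sum_card_uncovered_le hM hJ τ (fun j => ∑ i, w i * d j i) hdr
    (fun j j' _ _ => even_sum_sub_sum w (hd j) (hd j')))
  push_cast
  refine Finset.sum_le_sum fun u _ => Nat.cast_le.2 (Finset.card_le_card fun y hy => ?_)
  obtain ⟨hy, hbad⟩ := Finset.mem_filter.1 hy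
  exact Finset.mem_filter.2 ⟨hy, fun ⟨c, hc, j, _, h⟩ => hbad ⟨c, hc, d j, hd j, h⟩⟩

theorem one_sub_solutionProb_le {m k M D : ℕ} (hM : 2 ≤ M) (hD : 2 ≤ D) (hk : 32 * D ^ 2 ≤ k)
    {J : ℤ} (hJ : 0 < J) {τ : ℤ}
    (hτ : |(τ : ℝ)| + (J + 1) * M ≤ ((k : ℝ) / 12 - 4 * D) * M) :
    1 - solutionProb (m + k + 1) M (coeffSet 1) {τ, τ + 1} ≤
      28 * D / k + (2 * m / (J : ℝ) ^ 2 + M * (m + 1) / (2 * 2 ^ m) +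
        (8 * (max 1 (M / D) : ℕ) + 5 / 2) / M) := by
  classical
  set e := max 1 (M / D) with he
  have hM0 : (0 : ℝ) < M := by positivity
  rw [one_sub_solutionProb_coeffSet_one (by omega), div_le_iff₀ (by positivity)]
  set K : ℝ := (2 * e + 1) + 2 * M * m / (J : ℝ) ^ 2 + (M : ℝ) ^ 2 * (m + 1) / (2 * 2 ^ m)
        + 3 * (4 * e + 1) / 2 with hK
  have hK0 : 0 ≤ K := by positivity
  have hpt : ∀ w ∈ intBox k M, ((∑ u ∈ intBox m M, ((Finset.Ico (0 : ℤ) M).filter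
      fun y => ¬ SplitSolvable τ w u y).card : ℕ) : ℝ) ≤
      (M : ℝ) ^ m * ((if ¬ Steerable e (((k : ℝ) / 12 - 4 * D) * M) w then 1 else 0) * M + K) := by
    intro w _
    split_ifs with hs
    · rw [zero_mul, zero_add]
      exact sum_card_split_unsolvable_le_of_steerable (by omega) hJ τ hτ hs
    -- For a non-steerable `w` everything is counted as bad; such `w` are rare.
    · have h : (∑ u ∈ intBox m M, ((Finset.Ico (0 : ℤ) M).filter
          fun y => ¬ SplitSolvable τ w u y).card) ≤ M ^ m * M := by
        rw [← card_intBox, ← smul_eq_mul]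
        refine Finset.sum_le_card_nsmul _ _ _ fun u _ => (Finset.card_filter_le _ _).trans ?_
        simp
      refine (Nat.cast_le.2 h).trans ?_
      push_cast
      gcongr
      linarith
  refine (Nat.cast_le.2 (card_unsolvable_le_sum_split m k M τ)).trans ?_
  rw [Nat.cast_sum]
  refine (Finset.sum_le_sum hpt).trans ?_
  rw [← Finset.mul_sum, Finset.sum_add_distrib, ← Finset.sum_mul, Finset.sum_boole,
    Finset.sum_const, card_intBox, nsmul_eq_mul]
  have hsteer := card_not_steerable_le hM hD hk
  rw [← he] at hsteer
  have h2 : (2 * m / (J : ℝ) ^ 2 + M * (m + 1) / (2 * 2 ^ m) + (8 * (e : ℝ) + 5 / 2) / M) =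
      K / M := by
    rw [hK]; field_simp; ring
  rw [h2]
  calc _ ≤ (M : ℝ) ^ m * ((M : ℝ) ^ k * (28 * D / k) * M + (M : ℝ) ^ k * K) := by
        push_cast
        gcongr
    _ = _ := by
        rw [pow_succ, pow_add]; field_simp

/-! ### Choice of parameters and the limit. -/

/-- Steering costs only a quarter of the exponent gain εn, so M/2^(m+1) is still at most 2^(-3εn/4).
-/
theorem natCast_mul_div_two_pow_le {n m k M : ℕ} {ε : ℝ} (hn : n = m + k + 1)
    (hk : (k : ℝ) ≤ ε * n / 4) (hM : (M : ℝ) ≤ 2 ^ ((1 - ε) * (n : ℝ))) :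
    (M : ℝ) * (m + 1) / (2 * 2 ^ m) ≤ n * ((2 : ℝ) ^ (-(3 / 4 * ε))) ^ n := by
  have hnr : (n : ℝ) = m + k + 1 := by exact_mod_cast hn
  have hk0 : (0 : ℝ) ≤ k := Nat.cast_nonneg k
  have h1 : (2 : ℝ) * 2 ^ m = (2 : ℝ) ^ ((m : ℝ) + 1) := by
    rw [Real.rpow_add_one two_ne_zero, Real.rpow_natCast, mul_comm]
  have h2 : (M : ℝ) ≤ ((2 : ℝ) ^ (-(3 / 4 * ε))) ^ n * (2 * 2 ^ m) := by
    rw [h1, ← Real.rpow_mul_natCast zero_le_two, ← Real.rpow_add two_pos]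
    refine hM.trans (Real.rpow_le_rpow_of_exponent_le one_le_two ?_)
    nlinarith
  rw [div_le_iff₀ (by positivity)]
  calc (M : ℝ) * (m + 1) ≤ (((2 : ℝ) ^ (-(3 / 4 * ε))) ^ n * (2 * 2 ^ m)) * n := by
        gcongr
        linarith
    _ = _ := by ring

theorem eventually_one_sub_solutionProb_le {ε : ℝ} (hε : 0 < ε) (hε1 : ε < 1) {ω : ℕ → ℝ}
    (hω : Tendsto ω atTop (𝓝 0)) {θ : ℝ} (hθ : 0 < θ) :
    ∀ᶠ n : ℕ in atTop, ∀ (M : ℕ) (τ : ℤ), 2 ≤ M → |(τ : ℝ)| ≤ ω n * ((M : ℝ) * (n : ℝ)) →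
      (M : ℝ) ≤ 2 ^ ((1 - ε) * (n : ℝ)) →
        1 - solutionProb n M (coeffSet 1) {τ, τ + 1} ≤ θ := by
  -- For M ≥ D the rounding term (8⌊M/D⌋ + 5/2)/M is at most 21/(2D), hence at most θ/2.
  obtain ⟨D, hDθ⟩ := exists_nat_ge (21 / θ + 2)
  have hDθ0 : 0 < 21 / θ := by positivity
  have hD2r : (2 : ℝ) ≤ D := by linarith
  have hD2 : 2 ≤ D := by exact_mod_cast hD2r
  have hDθ' : 21 / (D : ℝ) ≤ θ := by
    rw [div_le_iff₀ (by linarith)]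
    rw [div_add' _ _ _ hθ.ne', div_le_iff₀ hθ] at hDθ
    linarith
  have hr0 : (0 : ℝ) < 2 ^ (-(3 / 4 * ε)) := by positivity
  have hr1 : (2 : ℝ) ^ (-(3 / 4 * ε)) < 1 :=
    Real.rpow_lt_one_of_one_lt_of_neg one_lt_two (by linarith)
  have hlim : Tendsto (fun n : ℕ => (224 * D / ε + 1280000 / ε ^ 2) * (n : ℝ)⁻¹ +
      n * ((2 : ℝ) ^ (-(3 / 4 * ε))) ^ n) atTop (𝓝 0) := by
    have h1 := (tendsto_inv_atTop_nhds_zero_nat (𝕜 := ℝ)).const_mul (224 * D / ε + 1280000 / ε ^ 2)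
    have h2 := h1.add (tendsto_self_mul_const_pow_of_lt_one hr0.le hr1)
    simpa using h2
  filter_upwards [hlim.eventually_le_const (half_pos hθ),
    hω.eventually_le_const (by positivity : (0 : ℝ) < ε / 800),
    tendsto_natCast_atTop_atTop.eventually_ge_atTop
      ((800 + 256 * (D : ℝ) ^ 2 + 150 * (1 + 4 * D)) / ε)] with n hn1 hωn hn M τ hM hτ hMn
  rw [div_le_iff₀ hε] at hn
  have hD2pos : (0 : ℝ) ≤ (D : ℝ) ^ 2 := by positivity
  have hn0 : (0 : ℝ) < n := by
    by_contra h
    nlinarith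
  have hεn : ε * n ≤ n := by nlinarith
  have hMr : (2 : ℝ) ≤ M := by exact_mod_cast hM
  have hpow : 0 ≤ (n : ℝ) * ((2 : ℝ) ^ (-(3 / 4 * ε))) ^ n := by positivity
  have hτ' : |(τ : ℝ)| ≤ ε / 800 * n * M := by
    refine hτ.trans ?_
    rw [mul_comm (M : ℝ), ← mul_assoc]
    gcongr
  rcases lt_or_ge M D with hMD | hMD
  · refine (one_sub_solutionProb_le_of_lt hM hMD ?_ ?_).trans ?_
    · have : (32 : ℝ) * D ^ 2 ≤ n := by nlinarith
      exact_mod_cast this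
    · have : ε / 800 * n + 1 ≤ (n : ℝ) / 12 - 4 * D := by linarith
      have := mul_le_mul_of_nonneg_right this (by linarith : (0 : ℝ) ≤ M)
      linarith
    · have h1 : 28 * D / (n : ℝ) ≤ (224 * D / ε + 1280000 / ε ^ 2) * (n : ℝ)⁻¹ := by
        rw [div_eq_mul_inv]
        have h2 : (28 : ℝ) * D ≤ 224 * D / ε := by
          rw [le_div_iff₀ hε]
          nlinarith
        have h3 : (0 : ℝ) ≤ 1280000 / ε ^ 2 := by positivity
        gcongr
        linarith
      linarith
  -- Both `k` and `J` are linear in n. The steering range, about εnM/48, exceeds |τ| + (J + 1)M, and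
  -- m/J² is still O(1/n).
  · obtain ⟨k, hk⟩ : ∃ k : ℕ, k = ⌊ε * n / 4⌋₊ := ⟨_, rfl⟩
    obtain ⟨J, hJ⟩ : ∃ J : ℤ, J = ⌊ε * n / 400⌋ := ⟨_, rfl⟩
    have hk1 : (k : ℝ) ≤ ε * n / 4 := hk ▸ Nat.floor_le (by positivity)
    have hk2 : ε * n / 4 < k + 1 := hk ▸ Nat.lt_floor_add_one _
    have hJ1 : (J : ℝ) ≤ ε * n / 400 := hJ ▸ Int.floor_le _
    have hJ2 : ε * n / 400 < J + 1 := hJ ▸ Int.lt_floor_add_one _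
    have hk3 : ε * n / 8 ≤ k := by linarith
    have hJ3 : ε * n / 800 ≤ J := by linarith
    have hJ0r : (0 : ℝ) < J := by linarith
    have hJ0 : 0 < J := by exact_mod_cast hJ0r
    have hkn : k + 1 ≤ n := by
      have : (k : ℝ) + 1 ≤ n := by linarith
      exact_mod_cast this
    obtain ⟨m, hm⟩ : ∃ m, n = m + k + 1 := ⟨n - (k + 1), by omega⟩
    have hnr : (n : ℝ) = m + k + 1 := by exact_mod_cast hm
    have hk0r : (0 : ℝ) ≤ k := Nat.cast_nonneg k
    have hkD : 32 * D ^ 2 ≤ k := by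
      have : (32 : ℝ) * (D : ℝ) ^ 2 ≤ k := by linarith
      exact_mod_cast this
    have hrange : |(τ : ℝ)| + (J + 1) * M ≤ ((k : ℝ) / 12 - 4 * D) * M := by
      have : ε / 800 * n + (J + 1) ≤ (k : ℝ) / 12 - 4 * D := by linarith
      have := mul_le_mul_of_nonneg_right this (by linarith : (0 : ℝ) ≤ M)
      linarith
    have hmain := one_sub_solutionProb_le (m := m) (k := k) (τ := τ) hM hD2 hkD hJ0 hrange
    rw [← hm] at hmain
    have t1 : 28 * D / (k : ℝ) ≤ 224 * D / ε * (n : ℝ)⁻¹ := by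
      calc 28 * D / (k : ℝ) ≤ 28 * D / (ε * n / 8) := by gcongr
        _ = _ := by field_simp; norm_num
    have t2 : 2 * m / (J : ℝ) ^ 2 ≤ 1280000 / ε ^ 2 * (n : ℝ)⁻¹ := by
      calc 2 * m / (J : ℝ) ^ 2 ≤ 2 * n / (ε * n / 800) ^ 2 := by
            gcongr
            linarith
        _ = _ := by field_simp; norm_num
    have t3 := natCast_mul_div_two_pow_le hm hk1 hMn
    have t4 : (8 * (max 1 (M / D) : ℕ) + 5 / 2) / (M : ℝ) ≤ θ / 2 := by
      have hmax : max 1 (M / D) = M / D :=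
        max_eq_right (Nat.div_pos hMD (by omega))
      rw [hmax]
      have h1 : ((M / D : ℕ) : ℝ) ≤ M / D := Nat.cast_div_le
      have h2 : (D : ℝ) ≤ M := by exact_mod_cast hMD
      have h3 : (1 : ℝ) ≤ M / D := by rw [one_le_div (by linarith)]; exact h2
      rw [div_le_iff₀ (by linarith)]
      calc 8 * ((M / D : ℕ) : ℝ) + 5 / 2 ≤ 21 / 2 * (M / D) := by linarith
        _ = 21 / D / 2 * M := by ring
        _ ≤ θ / 2 * M := by gcongr
    have : (224 * D / ε + 1280000 / ε ^ 2) * (n : ℝ)⁻¹ =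
      224 * D / ε * (n : ℝ)⁻¹ + 1280000 / ε ^ 2 * (n : ℝ)⁻¹ := by ring
    linarith

theorem mainTheorem8 (ε : ℝ) (hε : 0 < ε) (ω : ℕ → ℝ) (hω : Tendsto ω atTop (𝓝 0)) :
    ∃ η : ℕ → ℝ, Tendsto η atTop (𝓝 0) ∧
      ∀ (n M : ℕ) (τ : ℤ), 1 ≤ n → 2 ≤ M → |(τ : ℝ)| ≤ ω n * ((M : ℝ) * (n : ℝ)) →
        ((M : ℝ) ≤ ((coeffSet 1).ncard : ℝ) ^ ((1 - ε) * (n : ℝ)) →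
          1 - η n ≤ solutionProb n M (coeffSet 1) {τ, τ + 1}) ∧
        (((coeffSet 1).ncard : ℝ) ^ n ≤ (M : ℝ) →
          solutionProb n M (coeffSet 1) {τ, τ + 1} ≤
            2 * ((coeffSet 1).ncard : ℝ) ^ n / (M : ℝ)) := by
  rw [ncard_coeffSet_one, Nat.cast_ofNat]
  -- The error η(n) is the worst failure probability over all admissible `M` and `τ`; adjoining 0
  -- keeps the set nonempty and the supremum nonnegative.
  let V : ℕ → Set ℝ := fun n => {v | v = 0 ∨ ∃ (M : ℕ) (τ : ℤ), 2 ≤ M ∧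
    |(τ : ℝ)| ≤ ω n * ((M : ℝ) * (n : ℝ)) ∧ (M : ℝ) ≤ 2 ^ ((1 - ε) * (n : ℝ)) ∧
      v = 1 - solutionProb n M (coeffSet 1) {τ, τ + 1}}
  have hbdd : ∀ n, BddAbove (V n) := by
    refine fun n => ⟨1, ?_⟩
    rintro v (rfl | ⟨M, τ, -, -, -, rfl⟩)
    · exact zero_le_one
    · exact sub_le_self _ MeasureTheory.measureReal_nonneg
  refine ⟨fun n => sSup (V n), ?_, fun n M τ hn hM hτ => ⟨fun hMn => ?_, fun _ => ?_⟩⟩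
  · rcases lt_or_ge ε 1 with hε1 | hε1
    · rw [Metric.tendsto_atTop']
      intro θ hθ
      obtain ⟨N, hN⟩ := eventually_atTop.1
        (eventually_one_sub_solutionProb_le hε hε1 hω (half_pos hθ))
      refine ⟨N, fun n hn => ?_⟩
      have h0 : 0 ≤ sSup (V n) := le_csSup (hbdd n) (Or.inl rfl)
      have h1 : sSup (V n) ≤ θ / 2 := by
        refine csSup_le ⟨0, Or.inl rfl⟩ ?_
        rintro v (rfl | ⟨M, τ, hM, hτ, hMn, rfl⟩)
        · exact (half_pos hθ).le
        · exact hN n hn.le M τ hM hτ hMn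
      rw [Real.dist_eq, sub_zero, abs_of_nonneg h0]
      linarith
    -- For ε ≥ 1 the bound forces M ≤ 1, so no pair is admissible and η = 0.
    · refine tendsto_const_nhds.congr fun n => ?_
      have h0 : 0 ≤ sSup (V n) := le_csSup (hbdd n) (Or.inl rfl)
      have hne : (V n).Nonempty := ⟨0, Or.inl rfl⟩
      refine (le_antisymm (csSup_le hne ?_) h0).symm
      rintro v (rfl | ⟨M, τ, hM, hτ, hMn, rfl⟩)
      · exact le_rfl
      · have h2 : (2 : ℝ) ^ ((1 - ε) * (n : ℝ)) ≤ 1 :=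
          Real.rpow_le_one_of_one_le_of_nonpos one_le_two
            (mul_nonpos_of_nonpos_of_nonneg (by linarith) (Nat.cast_nonneg n))
        have h3 : (2 : ℝ) ≤ M := by exact_mod_cast hM
        linarith
  · have : 1 - solutionProb n M (coeffSet 1) {τ, τ + 1} ≤ sSup (V n) :=
      le_csSup (hbdd n) (Or.inr ⟨M, τ, hM, hτ, hMn, rfl⟩)
    linarith
  · exact solutionProb_pair_le hn (by omega) τ
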